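/- Let $n\ge 1$ be an integer. For $s\in(0,n]$ let $\mathcal H^{s}_\infty(E)=\inf\sum_i r_i^{s}$ be the $s$-dimensional Hausdorff content of an arbitrary set $E\subset\mathbb R^n$, the infimum being over all countable or finite covers of $E$ by open balls $B(x_i,r_i)$. For an arbitrary (not necessarily measurable) function $g$ with values in $[0,\infty]$ and a set $\Omega\subset\mathbb R^n$ let $$\int_\Omega g\,d\mathcal H^{s}_\infty:=\int_0^\infty \mathcal H^{s}_\infty(\{x\in\Omega: g(x)>t\})\,dt$$ be the Choquet integral. For $f:\mathbb R^n\to[-\infty,\infty]$ and an open ball $B$ put $$f_B:=\frac1{\mathcal H^{n}_\infty(B)}\int_B|f|\,d\mathcal H^{n}_\infty,\qquad \mathcal M^{\#}f(x):=\sup_{B\ni x}\frac1{\mathcal H^{n}_\infty(B)}\int_B|f(y)-f_B|\,d\mathcal H^{n}_\infty(y),$$ where the supremum is over all open balls $B$ containing $x$. Proposition. Let $\delta\in(0,n]$ and $p\in(\delta/n,\infty)$. Then there is a finite constant $c$ depending only on $n$, $\delta$ and $p$ such that $$\int_{\mathbb R^n}(\mathcal M^{\#}f)^p\,d\mathcal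 H^{\delta}_\infty\le c\int_{\mathbb R^n}|f|^p\,d\mathcal H^{\delta}_\infty$$ for every function $f:\mathbb R^n\to[-\infty,\infty]$ with $\int_{\mathbb R^n}|f|^p\,d\mathcal H^{\delta}_\infty<\infty$, that is, for every $f\in \mathrm{N}L^p(\mathbb R^n,\mathcal H^{\delta}_\infty)$. -/

import Mathlib

open scoped ENNReal NNReal

/-- The `δ`-dimensional Hausdorff content of `A ⊆ ℝⁿ`: the infimum of `∑ rᵢ ^ δ` over all finite or
countable covers of `A` by open balls `B(xᵢ, rᵢ)`. The radius `0` is allowed: as `B(x, 0) = ∅` and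
`0 ^ δ = 0` for `δ > 0`, such terms are void, and so finite covers are included. -/
noncomputable def hausdorffContent (n : ℕ) (δ : ℝ) (A : Set (EuclideanSpace ℝ (Fin n))) : ℝ≥0∞ :=
  ⨅ (x : ℕ → EuclideanSpace ℝ (Fin n)) (r : ℕ → ℝ≥0)
    (_ : A ⊆ ⋃ i, Metric.ball (x i) (r i)), ∑' i, (r i : ℝ≥0∞) ^ δ

/-- The Choquet integral `∫_Ω g dH = ∫₀^∞ H {x ∈ Ω | g x > t} dt` of an arbitrary function
`g` with values in `[0, ∞]` with respect to a set function `H`. -/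
noncomputable def choquetIntegral {X : Type*} (H : Set X → ℝ≥0∞) (Ω : Set X) (g : X → ℝ≥0∞) :
    ℝ≥0∞ :=
  ∫⁻ t in Set.Ioi (0 : ℝ), H {x ∈ Ω | ENNReal.ofReal t < g x}

/-- The functions `f : ℝⁿ → [-∞, ∞]`, measurable or not, such that the Choquet integral of
`|f| ^ p` with respect to the `δ`-dimensional Hausdorff content is finite. -/
def NLp (n : ℕ) (p δ : ℝ) : Set (EuclideanSpace ℝ (Fin n) → EReal) :=
  {f | choquetIntegral (hausdorffContent n δ) Set.univ (fun x => (f x).abs ^ p) < ∞}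

/-- The Choquet integral average `f_{B,δ} = H(B)⁻¹ ∫_B |f| dH`, where `H` is the `δ`-dimensional
Hausdorff content. -/
noncomputable def contentAverage (n : ℕ) (δ : ℝ) (f : EuclideanSpace ℝ (Fin n) → EReal)
    (B : Set (EuclideanSpace ℝ (Fin n))) : ℝ≥0∞ :=
  (hausdorffContent n δ B)⁻¹ *
    choquetIntegral (hausdorffContent n δ) B (fun y => (f y).abs)

/-- The Hausdorff content sharp maximal function: the supremum, over all open balls `B` containing
`x`, of `H(B)⁻¹ ∫_B |f - f_{B,δ}| dH`. (Membership in `ball z r` forces `0 < r`.) -/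
noncomputable def sharpMaximalFunction (n : ℕ) (δ : ℝ) (f : EuclideanSpace ℝ (Fin n) → EReal)
    (x : EuclideanSpace ℝ (Fin n)) : ℝ≥0∞ :=
  ⨆ (z : EuclideanSpace ℝ (Fin n)) (r : ℝ) (_ : x ∈ Metric.ball z r),
    (hausdorffContent n δ (Metric.ball z r))⁻¹ *
      choquetIntegral (hausdorffContent n δ) (Metric.ball z r)
        (fun y => (f y - (contentAverage n δ f (Metric.ball z r) : EReal)).abs)

/-!
The sharp function of `f` is controlled by the Hardy–Littlewood maximal function of a measurable
majorant of `|f|`, since the `n`-dimensional content is comparable to Lebesgue outer measure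
(`volume_le_hausdorffContent`, `hausdorffContent_le_volume`); this is `sharpMaximalFunction_le`. The
majorants used are `2 ^ k + ∑ᵢ aᵢ 1_{Bᵢ}`, where the balls `Bᵢ` run through nearly optimal covers of
the sets `{|f| > 2 ^ l}`, `l ≥ k`, and `aᵢ = 2 ^ (l + 1)`.

The maximal function of `∑ᵢ aᵢ 1_{Bᵢ}` satisfies the weak type bound
`t ^ q * H {M > t} ≤ C * ∑ᵢ aᵢ ^ q * rᵢ ^ δ` for some `q < p` (`exists_weakType`). If `δ = n`, then
`q = 1` and this is the Vitali covering argument. If `δ < n`, take `δ / n < q ≤ 1`; then the `q`-th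
power of the maximal function is at most a weighted sum of indicators of dilates of the `Bᵢ`. What
is needed is that the content, which is not a measure, is bounded by the cost of any *weighted*
cover (`hausdorffContent_mul_le_tsum`). For dyadic cubes this follows by selecting, for a level
`θ ∈ (0, s)`, the cubes at which the total weight of the cubes containing a point, accumulated from
large cubes to small ones, crosses `θ`: the selected cubes form a cover for every `θ`, and the
integral of their cost over `θ` is at most the weighted cost (`mul_le_tsum_of_nested`).

Finally the weak type bounds at the levels `t = 2 ^ k`, applied to the part of `|f|` above `2 ^ k`,
are summed against `2 ^ (k p)`. As `q < p` this gives a geometric series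
(`tsum_hausdorffContent_maximalSuperlevel_le`), and both Choquet integrals are comparable to sums
over dyadic levels.
-/

/-! ### Hausdorff content and Lebesgue measure -/

section ContentBasics

open MeasureTheory

variable {n : ℕ} {δ : ℝ}

theorem ENNReal.le_mul_of_forall_le_mul_add {M S X : ℝ≥0∞} (hM : M ≠ ∞)
    (h : ∀ ε : ℝ≥0∞, ε ≠ 0 → X ≤ M * (S + ε)) : X ≤ M * S := by
  rcases eq_or_ne M 0 with rfl | hM0
  · simpa using h 1 one_ne_zero
  rw [mul_comm, ← ENNReal.div_le_iff hM0 hM]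
  refine le_of_forall_gt fun c hc => ?_
  obtain ⟨ε, hε, hlt⟩ := ENNReal.lt_iff_exists_add_pos_lt.1 hc
  refine lt_of_le_of_lt ?_ hlt
  rw [ENNReal.div_le_iff hM0 hM, mul_comm]
  exact h ε (by exact_mod_cast hε.ne')

theorem hausdorffContent_mono {A B : Set (EuclideanSpace ℝ (Fin n))} (h : A ⊆ B) :
    hausdorffContent n δ A ≤ hausdorffContent n δ B :=
  iInf_mono fun _ => iInf_mono fun _ => iInf_mono' fun hB => ⟨h.trans hB, le_rfl⟩

/-- The content is bounded by the cost of a cover indexed by any countable type. -/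
theorem hausdorffContent_le_tsum (hδ : 0 < δ) {ι : Type*} [Countable ι]
    {A : Set (EuclideanSpace ℝ (Fin n))} (x : ι → EuclideanSpace ℝ (Fin n)) (r : ι → ℝ≥0)
    (h : A ⊆ ⋃ i, Metric.ball (x i) (r i)) :
    hausdorffContent n δ A ≤ ∑' i, (r i : ℝ≥0∞) ^ δ := by
  obtain ⟨e, he⟩ := Countable.exists_injective_nat ι
  have hcov : A ⊆ ⋃ k, Metric.ball
      (Function.extend e x 0 k) ((Function.extend e r (fun _ => (0 : ℝ≥0)) k : ℝ≥0) : ℝ) := by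
    intro y hy
    obtain ⟨i, hi⟩ := Set.mem_iUnion.1 (h hy)
    refine Set.mem_iUnion.2 ⟨e i, ?_⟩
    rwa [he.extend_apply, he.extend_apply]
  rw [hausdorffContent]
  refine iInf_le_of_le _ (iInf_le_of_le _ (iInf_le_of_le hcov (le_of_eq ?_)))
  rw [← he.tsum_eq (f := fun k => ((Function.extend e r (fun _ => (0 : ℝ≥0)) k : ℝ≥0) : ℝ≥0∞) ^ δ)]
  · simp only [he.extend_apply]
  · intro k hk
    by_contra hk'
    apply hk
    simp only [Function.extend_apply' _ _ _ hk']
    simp [hδ]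

theorem exists_cover_tsum_le {A : Set (EuclideanSpace ℝ (Fin n))} {η : ℝ≥0∞} (hη : η ≠ 0)
    (hA : hausdorffContent n δ A ≠ ∞) :
    ∃ (x : ℕ → EuclideanSpace ℝ (Fin n)) (r : ℕ → ℝ≥0),
      A ⊆ (⋃ i, Metric.ball (x i) (r i)) ∧
      ∑' i, (r i : ℝ≥0∞) ^ δ ≤ hausdorffContent n δ A + η := by
  have h := ENNReal.lt_add_right hA hη
  conv_lhs at h => rw [hausdorffContent]
  simp only [iInf_lt_iff] at h
  obtain ⟨x, r, hc, hlt⟩ := h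
  exact ⟨x, r, hc, hlt.le⟩

theorem volume_ball_eq (hn : 1 ≤ n) (x : EuclideanSpace ℝ (Fin n)) (r : ℝ≥0) :
    volume (Metric.ball x (r : ℝ)) =
      (r : ℝ≥0∞) ^ (n : ℝ) * volume (Metric.ball (0 : EuclideanSpace ℝ (Fin n)) 1) := by
  have : Nonempty (Fin n) := ⟨⟨0, hn⟩⟩
  have : Nontrivial (EuclideanSpace ℝ (Fin n)) := inferInstance
  rw [Measure.addHaar_ball _ _ r.coe_nonneg, finrank_euclideanSpace_fin,
    ENNReal.ofReal_pow r.coe_nonneg, ENNReal.rpow_natCast]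
  simp

theorem volume_unitBall_ne_zero :
    volume (Metric.ball (0 : EuclideanSpace ℝ (Fin n)) 1) ≠ 0 :=
  (Metric.measure_ball_pos _ _ one_pos).ne'

theorem volume_unitBall_ne_top :
    volume (Metric.ball (0 : EuclideanSpace ℝ (Fin n)) 1) ≠ ∞ :=
  measure_ball_lt_top.ne

theorem volume_le_hausdorffContent (hn : 1 ≤ n) (A : Set (EuclideanSpace ℝ (Fin n))) :
    volume A ≤ hausdorffContent n n A *
      volume (Metric.ball (0 : EuclideanSpace ℝ (Fin n)) 1) := by
  rw [← ENNReal.div_le_iff volume_unitBall_ne_zero volume_unitBall_ne_top]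
  refine le_iInf fun x => le_iInf fun r => le_iInf fun h => ?_
  rw [ENNReal.div_le_iff volume_unitBall_ne_zero volume_unitBall_ne_top, ← ENNReal.tsum_mul_right]
  refine (measure_mono h).trans ((measure_iUnion_le _).trans (ENNReal.tsum_le_tsum fun i => ?_))
  rw [volume_ball_eq hn]

/-- A Besicovitch cover by balls of nearly optimal total volume shows that the `n`-dimensional
content is dominated by Lebesgue outer measure. -/
theorem hausdorffContent_le_volume (hn : 1 ≤ n) (A : Set (EuclideanSpace ℝ (Fin n))) :
    hausdorffContent n n A ≤
      2 ^ (n : ℝ) / volume (Metric.ball (0 : EuclideanSpace ℝ (Fin n)) 1) * volume A := by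
  set ω := volume (Metric.ball (0 : EuclideanSpace ℝ (Fin n)) 1) with hω
  have hω0 : ω ≠ 0 := volume_unitBall_ne_zero
  have hωt : ω ≠ ∞ := volume_unitBall_ne_top
  have hn0 : (0 : ℝ) < n := by exact_mod_cast hn
  have hcoef : 2 ^ (n : ℝ) / ω ≠ ∞ := ENNReal.div_ne_top (by simp) hω0
  have key : ∀ ε : ℝ≥0∞, ε ≠ 0 →
      hausdorffContent n n A ≤ 2 ^ (n : ℝ) / ω * (volume A + ε) := by
    intro ε hε
    obtain ⟨t, r, htc, -, hr, hcov, hsum⟩ :=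
      Besicovitch.exists_closedBall_covering_tsum_measure_le
        (volume : Measure (EuclideanSpace ℝ (Fin n))) hε (fun _ => Set.Ioi 0) A
        (fun x _ d hd => ⟨d / 2, by simp [hd]⟩)
    have := htc.to_subtype
    have hc : A ⊆ ⋃ i : t, Metric.ball (i : EuclideanSpace ℝ (Fin n))
        ((2 * (r i).toNNReal : ℝ≥0) : ℝ) := by
      intro y hy
      obtain ⟨i, hi, hyi⟩ := Set.mem_iUnion₂.1 (hcov hy)
      refine Set.mem_iUnion.2 ⟨⟨i, hi⟩, ?_⟩
      have h0 : 0 < r i := hr i hi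
      have := Metric.mem_closedBall.1 hyi
      simp only [Metric.mem_ball, NNReal.coe_mul, NNReal.coe_ofNat, Real.coe_toNNReal _ h0.le]
      linarith
    refine (hausdorffContent_le_tsum hn0 _ _ hc).trans ?_
    refine le_trans ?_ (mul_le_mul_right hsum _)
    rw [← ENNReal.tsum_mul_left]
    refine ENNReal.tsum_le_tsum fun i => ?_
    have h0 : 0 < r i := hr i i.2
    have h1 : volume (Metric.ball (i : EuclideanSpace ℝ (Fin n)) ((r i).toNNReal : ℝ)) ≤
        volume (Metric.closedBall (i : EuclideanSpace ℝ (Fin n)) (r i)) := by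
      rw [Real.coe_toNNReal _ h0.le]
      exact measure_mono Metric.ball_subset_closedBall
    refine le_trans (le_of_eq ?_) (mul_le_mul_right h1 _)
    rw [volume_ball_eq hn, ← hω, ENNReal.coe_mul, ENNReal.mul_rpow_of_nonneg _ _ hn0.le,
      mul_comm _ ω, ← mul_assoc, ENNReal.div_mul_cancel hω0 hωt]
    simp
  exact ENNReal.le_mul_of_forall_le_mul_add hcoef key

end ContentBasics

/-! ### Selection of cells in nested partitions -/

section LaminarSelection

open MeasureTheory Filter Topology

variable {X T : Type*}

/-- For weights `a` on the cells of a sequence of partitions `π k` of `X`, the total weight of the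
cells of generation at least `k` that contain `x`. -/
noncomputable def coarseWeight (π : ℤ → X → T) (a : ℤ → T → ℝ≥0∞) (k : ℤ) (x : X) : ℝ≥0∞ :=
  ∑' j : ℕ, a (k + j) (π (k + j) x)

theorem coarseWeight_eq_add (π : ℤ → X → T) (a : ℤ → T → ℝ≥0∞) (k : ℤ) (x : X) :
    coarseWeight π a k x = a k (π k x) + coarseWeight π a (k + 1) x := by
  rw [coarseWeight, tsum_eq_zero_add' ENNReal.summable, coarseWeight]
  simp only [Nat.cast_zero, add_zero, Nat.cast_add, Nat.cast_one, add_assoc, add_comm (1 : ℤ)]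

theorem coarseWeight_antitone (π : ℤ → X → T) (a : ℤ → T → ℝ≥0∞) (x : X) :
    Antitone fun k => coarseWeight π a k x :=
  antitone_int_of_succ_le fun k => by
    rw [coarseWeight_eq_add π a k x]
    exact le_add_self

theorem coarseWeight_congr {π : ℤ → X → T} (hπ : ∀ k x y, π k x = π k y → π (k + 1) x = π (k + 1) y)
    (a : ℤ → T → ℝ≥0∞) {k : ℤ} {x y : X} (h : π k x = π k y) :
    coarseWeight π a k x = coarseWeight π a k y := by
  have key : ∀ j : ℕ, π (k + j) x = π (k + j) y := by
    intro j
    induction j with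
    | zero => simpa using h
    | succ j ih => simpa [add_assoc] using hπ _ _ _ ih
  simp only [coarseWeight, key]

theorem exists_lt_coarseWeight {π : ℤ → X → T} {a : ℤ → T → ℝ≥0∞} {x : X} {t : ℝ≥0∞}
    (h : t < ∑' k, a k (π k x)) : ∃ k, t < coarseWeight π a k x := by
  rw [ENNReal.tsum_eq_iSup_sum] at h
  obtain ⟨F, hF⟩ := lt_iSup_iff.1 h
  obtain ⟨m, hm⟩ := F.bddBelow
  refine ⟨m, hF.trans_le ?_⟩
  have hinj : Function.Injective fun j : ℕ => m + (j : ℤ) := fun i j hij => by simpa using hij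
  have hsub : F ⊆ (F.image fun k => (k - m).toNat).image fun j : ℕ => m + (j : ℤ) := by
    intro k hk
    have : m ≤ k := hm hk
    simp only [Finset.mem_image, exists_exists_and_eq_and]
    exact ⟨k, hk, by omega⟩
  refine (Finset.sum_le_sum_of_subset hsub).trans ?_
  rw [Finset.sum_image hinj.injOn]
  exact ENNReal.sum_le_tsum _

theorem exists_coarseWeight_le {π : ℤ → X → T} {a : ℤ → T → ℝ≥0∞} {x : X} {t : ℝ≥0∞}
    (ht : 0 < t) (h : coarseWeight π a 0 x ≠ ∞) : ∃ k, coarseWeight π a k x ≤ t := by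
  have := ENNReal.tendsto_sum_nat_add _ h
  obtain ⟨i, hi⟩ := (this.eventually (ge_mem_nhds ht)).exists
  refine ⟨i, le_trans (le_of_eq ?_) hi⟩
  simp [coarseWeight, add_comm]

/-- Every level `t` lies, for each point `x` of total weight above `t`, in the jump of
`coarseWeight` at exactly one cell containing `x`. The cells whose jump contains `t` therefore cover
the superlevel set, and integrating the cost of this cover over `t ∈ (0, s)` gives the claim, since
the jump at a cell has length equal to its weight. -/
theorem mul_le_tsum_of_nested [Countable T] {π : ℤ → X → T}
    (hπ : ∀ k x y, π k x = π k y → π (k + 1) x = π (k + 1) y)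
    (a : ℤ → T → ℝ≥0∞) {w : ℤ → ℝ≥0∞} (hw : Monotone w) (hw0 : ∀ k, w k ≠ 0)
    (s : ℝ≥0) (c : ℝ≥0∞)
    (hc : ∀ 𝒮 : Set (ℤ × T), {x | (s : ℝ≥0∞) < ∑' k, a k (π k x)} ⊆ {x | ∃ k, (k, π k x) ∈ 𝒮} →
      c ≤ ∑' Q : ℤ × T, 𝒮.indicator (fun Q => w Q.1) Q) :
    c * s ≤ ∑' Q : ℤ × T, a Q.1 Q.2 * w Q.1 := by
  by_cases htot : ∑' Q : ℤ × T, a Q.1 Q.2 * w Q.1 = ∞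
  · rw [htot]; exact le_top
  have hfin : ∀ k x, coarseWeight π a k x ≠ ∞ := by
    intro k x h
    apply htot
    have h1 : ∑' j : ℕ, a (k + j) (π (k + j) x) * w (k + j) ≤ ∑' Q : ℤ × T, a Q.1 Q.2 * w Q.1 := by
      have hinj : Function.Injective fun j : ℕ => ((k + j, π (k + j) x) : ℤ × T) :=
        fun i j hij => by simpa using (Prod.ext_iff.1 hij).1
      exact ENNReal.tsum_comp_le_tsum_of_injective hinj (fun Q : ℤ × T => a Q.1 Q.2 * w Q.1)
    have h2 : coarseWeight π a k x * w k ≤ ∑' j : ℕ, a (k + j) (π (k + j) x) * w (k + j) := by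
      rw [coarseWeight, ← ENNReal.tsum_mul_right]
      exact ENNReal.tsum_le_tsum fun j => mul_le_mul_right (hw (by simp)) _
    rw [h, ENNReal.top_mul (hw0 k)] at h2
    exact top_le_iff.1 (h2.trans h1)
  -- `I Q` is the interval of levels that `coarseWeight` jumps over at the cell `Q`.
  set I : ℤ × T → Set ℝ := fun Q => {t | ∃ x, π Q.1 x = Q.2 ∧
    coarseWeight π a (Q.1 + 1) x ≤ ENNReal.ofReal t ∧ ENNReal.ofReal t < coarseWeight π a Q.1 x}
    with hI
  have hIx : ∀ k x, I (k, π k x) = {t | coarseWeight π a (k + 1) x ≤ ENNReal.ofReal t ∧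
      ENNReal.ofReal t < coarseWeight π a k x} := by
    intro k x
    ext t
    constructor
    · rintro ⟨y, hy, h1, h2⟩
      simp only at hy
      refine ⟨?_, ?_⟩
      · rwa [coarseWeight_congr hπ a (hπ _ _ _ hy)] at h1
      · rwa [coarseWeight_congr hπ a hy] at h2
    · rintro ⟨h1, h2⟩
      exact ⟨x, rfl, h1, h2⟩
  have hIe : ∀ Q, (¬ ∃ x, π Q.1 x = Q.2) → I Q = ∅ := by
    intro Q hQ
    ext t
    simp only [hI, Set.mem_ofPred_eq, Set.mem_empty_iff_false, iff_false]
    rintro ⟨x, hx, -⟩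
    exact hQ ⟨x, hx⟩
  have hImeas : ∀ Q, MeasurableSet (I Q) := by
    rintro ⟨k, T₀⟩
    by_cases hQ : ∃ x, π k x = T₀
    · obtain ⟨x, rfl⟩ := hQ
      rw [hIx]
      exact (measurableSet_le measurable_const ENNReal.measurable_ofReal).inter
        (measurableSet_lt ENNReal.measurable_ofReal measurable_const)
    · rw [hIe _ hQ]
      exact MeasurableSet.empty
  have hIvol : ∀ Q : ℤ × T, (volume.restrict (Set.Ioo (0 : ℝ) s)) (I Q) ≤ a Q.1 Q.2 := by
    rintro ⟨k, T₀⟩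
    by_cases hQ : ∃ x, π k x = T₀
    · obtain ⟨x, rfl⟩ := hQ
      rw [Measure.restrict_apply (hImeas _), hIx]
      have hsub : {t | coarseWeight π a (k + 1) x ≤ ENNReal.ofReal t ∧
          ENNReal.ofReal t < coarseWeight π a k x} ∩ Set.Ioo (0 : ℝ) s ⊆
          Set.Ico (coarseWeight π a (k + 1) x).toReal (coarseWeight π a k x).toReal := by
        rintro t ⟨⟨h1, h2⟩, h3, -⟩
        exact ⟨ENNReal.toReal_le_of_le_ofReal h3.le h1,
          (ENNReal.ofReal_lt_iff_lt_toReal h3.le (hfin _ _)).1 h2⟩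
      refine (measure_mono hsub).trans ?_
      rw [Real.volume_Ico, coarseWeight_eq_add π a k x, ENNReal.toReal_add _ (hfin _ _),
        add_sub_cancel_right]
      · exact ENNReal.ofReal_toReal_le
      · intro h
        apply hfin k x
        rw [coarseWeight_eq_add, h, top_add]
    · rw [hIe _ hQ]
      simp
  have hcov : ∀ t ∈ Set.Ioo (0 : ℝ) s, c ≤ ∑' Q : ℤ × T, (I Q).indicator (fun _ => w Q.1) t := by
    rintro t ⟨ht0, hts⟩
    have hts' : ENNReal.ofReal t < s := by
      rw [← ENNReal.ofReal_coe_nnreal]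
      exact (ENNReal.ofReal_lt_ofReal_iff_of_nonneg ht0.le).2 hts
    refine (hc {Q | t ∈ I Q} ?_).trans (le_of_eq (tsum_congr fun Q => ?_))
    · intro x hx
      obtain ⟨k, hk⟩ := exists_lt_coarseWeight (hts'.trans hx)
      obtain ⟨N, hN⟩ := exists_coarseWeight_le (ENNReal.ofReal_pos.2 ht0) (hfin 0 x)
      obtain ⟨u, hu, hmax⟩ := Int.exists_greatest_of_bdd
        (P := fun k => ENNReal.ofReal t < coarseWeight π a k x)
        ⟨N, fun z hz => by
          by_contra! hlt
          exact absurd (hz.trans_le (coarseWeight_antitone π a x hlt.le)) (not_lt.2 hN)⟩ ⟨k, hk⟩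
      refine ⟨u, ?_⟩
      rw [Set.mem_ofPred_eq, hIx]
      refine ⟨?_, hu⟩
      by_contra! hlt
      have := hmax _ hlt
      omega
    · by_cases h : t ∈ I Q
      · rw [Set.indicator_of_mem h, Set.indicator_of_mem (show Q ∈ {Q | t ∈ I Q} from h)]
      · rw [Set.indicator_of_notMem h, Set.indicator_of_notMem (show Q ∉ {Q | t ∈ I Q} from h)]
  calc c * s = ∫⁻ _ in Set.Ioo (0 : ℝ) s, c := by simp
    _ ≤ ∫⁻ t in Set.Ioo (0 : ℝ) s, ∑' Q : ℤ × T, (I Q).indicator (fun _ => w Q.1) t :=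
        setLIntegral_mono' measurableSet_Ioo hcov
    _ = ∑' Q : ℤ × T, ∫⁻ t in Set.Ioo (0 : ℝ) s, (I Q).indicator (fun _ => w Q.1) t :=
        lintegral_tsum fun Q => (measurable_const.indicator (hImeas Q)).aemeasurable
    _ ≤ ∑' Q : ℤ × T, a Q.1 Q.2 * w Q.1 := ENNReal.tsum_le_tsum fun Q => by
        rw [lintegral_indicator_const (hImeas Q), mul_comm]
        exact mul_le_mul_left (hIvol Q) _

end LaminarSelection

/-! ### The content and weighted covers -/

section WeightedContent

open MeasureTheory

variable {n : ℕ} {δ : ℝ}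

/-- The index `(⌊x j / 2 ^ k⌋)ⱼ` of the dyadic cube of side `2 ^ k` that contains `x`. -/
noncomputable def dyadicIndex (k : ℤ) (x : EuclideanSpace ℝ (Fin n)) : Fin n → ℤ :=
  fun j => ⌊x j / (2 : ℝ) ^ k⌋

theorem dyadicIndex_succ_congr (k : ℤ) (x y : EuclideanSpace ℝ (Fin n))
    (h : dyadicIndex k x = dyadicIndex k y) : dyadicIndex (k + 1) x = dyadicIndex (k + 1) y := by
  have key : ∀ z : EuclideanSpace ℝ (Fin n), dyadicIndex (k + 1) z =
      fun j => dyadicIndex k z j / 2 := by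
    intro z
    funext j
    have h2 : z j / (2 : ℝ) ^ (k + 1) = z j / (2 : ℝ) ^ k / (2 : ℕ) := by
      rw [zpow_add_one₀ two_ne_zero, div_div]
      norm_num
    rw [dyadicIndex, h2, Int.floor_div_natCast]
    rfl
  rw [key, key, h]

theorem mem_ball_of_dyadicIndex_eq {k : ℤ} {x : EuclideanSpace ℝ (Fin n)} {m : Fin n → ℤ}
    (h : dyadicIndex k x = m) :
    x ∈ Metric.ball (WithLp.toLp 2 fun j => (2 : ℝ) ^ k * m j) ((n + 1) * 2 ^ k) := by
  have h2 : (0 : ℝ) < 2 ^ k := by positivity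
  rw [Metric.mem_ball, EuclideanSpace.dist_eq, Real.sqrt_lt' (by positivity)]
  have hj : ∀ j, dist (x j) ((2 : ℝ) ^ k * m j) ^ 2 ≤ ((2 : ℝ) ^ k) ^ 2 := by
    intro j
    have hm : m j = ⌊x j / (2 : ℝ) ^ k⌋ := by rw [← h]; rfl
    have h3 := Int.floor_le (x j / (2 : ℝ) ^ k)
    have h4 := Int.lt_floor_add_one (x j / (2 : ℝ) ^ k)
    rw [← hm] at h3 h4
    rw [le_div_iff₀ h2] at h3
    rw [div_lt_iff₀ h2] at h4
    rw [Real.dist_eq, sq_abs]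
    apply pow_le_pow_left₀ <;> linarith
  have := Finset.sum_le_card_nsmul Finset.univ _ _ fun j _ => hj j
  refine this.trans_lt ?_
  rw [Finset.card_univ, Fintype.card_fin, nsmul_eq_mul, mul_pow]
  have hn : (0 : ℝ) ≤ n := Nat.cast_nonneg n
  exact mul_lt_mul_of_pos_right (by nlinarith) (by positivity)

/-- The indices of the cubes of side `2 ^ k` that are equal or adjacent to the one containing
`c`. -/
noncomputable def dyadicNeighbors (k : ℤ) (c : EuclideanSpace ℝ (Fin n)) : Finset (Fin n → ℤ) :=
  Fintype.piFinset fun j => Finset.Icc (dyadicIndex k c j - 1) (dyadicIndex k c j + 1)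

theorem card_dyadicNeighbors (k : ℤ) (c : EuclideanSpace ℝ (Fin n)) :
    (dyadicNeighbors k c).card = 3 ^ n := by
  rw [dyadicNeighbors, Fintype.card_piFinset]
  simp only [Int.card_Icc]
  have : ∀ j, (dyadicIndex k c j + 1 + 1 - (dyadicIndex k c j - 1)).toNat = 3 := fun j => by omega
  simp [this]

theorem dyadicIndex_mem_neighbors {k : ℤ} {x c : EuclideanSpace ℝ (Fin n)}
    (h : dist x c < 2 ^ k) : dyadicIndex k x ∈ dyadicNeighbors k c := by
  have h2 : (0 : ℝ) < 2 ^ k := by positivity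
  rw [dyadicNeighbors, Fintype.mem_piFinset]
  intro j
  have h1 : |x j - c j| < 2 ^ k := by
    refine lt_of_le_of_lt ?_ h
    rw [dist_eq_norm]
    exact PiLp.norm_apply_le (x - c) j
  have h3 : |x j / 2 ^ k - c j / 2 ^ k| < 1 := by
    rwa [← sub_div, abs_div, abs_of_pos h2, div_lt_one h2]
  rw [abs_lt] at h3
  rw [Finset.mem_Icc, dyadicIndex, dyadicIndex]
  constructor
  · rw [sub_le_iff_le_add, Int.floor_le_iff]
    have := Int.lt_floor_add_one (x j / (2 : ℝ) ^ k)
    push_cast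
    linarith [h3.1]
  · rw [Int.floor_le_iff]
    have := Int.lt_floor_add_one (c j / (2 : ℝ) ^ k)
    push_cast
    linarith [h3.2]

/-- Weighted covers are no cheaper than covers, up to a constant. Each ball is replaced by the
`3 ^ n` dyadic cubes of comparable side near its centre, and `mul_le_tsum_of_nested` is applied to
the partitions into dyadic cubes. -/
theorem hausdorffContent_mul_le_tsum (hδ : 0 < δ) {ι : Type*} [Countable ι]
    (c : ι → EuclideanSpace ℝ (Fin n)) (R : ι → ℝ≥0) (b : ι → ℝ≥0∞) (s : ℝ≥0) :
    hausdorffContent n δ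
        {x | (s : ℝ≥0∞) < ∑' i, (Metric.ball (c i) (R i)).indicator (fun _ => b i) x} * s ≤
      3 ^ n * (2 * (n + 1)) ^ δ * ∑' i, b i * (R i : ℝ≥0∞) ^ δ := by
  classical
  have hκ : ∀ i, ∃ k : ℤ, R i ≠ 0 → R i ≤ (2 : ℝ≥0) ^ k ∧ (2 : ℝ≥0) ^ k ≤ 2 * R i := by
    intro i
    by_cases h : R i = 0
    · exact ⟨0, fun h' => absurd h h'⟩
    · obtain ⟨k, hk⟩ := NNReal.exists_mem_Ioc_zpow h one_lt_two
      refine ⟨k + 1, fun _ => ⟨hk.2, ?_⟩⟩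
      rw [zpow_add_one₀ two_ne_zero, mul_comm]
      exact mul_le_mul_right hk.1.le _
  choose κ hκ using hκ
  -- Balls of radius zero are empty and are assigned no cubes.
  set N : ι → Finset (Fin n → ℤ) := fun i => if R i = 0 then ∅ else dyadicNeighbors (κ i) (c i)
    with hN
  set a : ℤ → (Fin n → ℤ) → ℝ≥0∞ := fun k m => ∑' i, if κ i = k ∧ m ∈ N i then b i else 0 with ha
  set w : ℤ → ℝ≥0∞ := fun k => (((n + 1) * 2 ^ k : ℝ≥0) : ℝ≥0∞) ^ δ with hw
  have hwmono : Monotone w := by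
    intro k l hkl
    refine ENNReal.rpow_le_rpow ?_ hδ.le
    norm_cast
    exact mul_le_mul_right (zpow_le_zpow_right₀ one_le_two hkl) _
  have hw0 : ∀ k, w k ≠ 0 := by
    intro k
    refine (ENNReal.rpow_pos ?_ ENNReal.coe_ne_top).ne'
    have : (0 : ℝ≥0) < (n + 1) * 2 ^ k := by positivity
    exact_mod_cast this
  have key := mul_le_tsum_of_nested (X := EuclideanSpace ℝ (Fin n)) (π := dyadicIndex)
    dyadicIndex_succ_congr a hwmono hw0 s (hausdorffContent n δ
        {x | (s : ℝ≥0∞) < ∑' i, (Metric.ball (c i) (R i)).indicator (fun _ => b i) x}) ?_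
  · refine key.trans ?_
    have h1 : ∀ i, ∑' Q : ℤ × (Fin n → ℤ), (if κ i = Q.1 ∧ Q.2 ∈ N i then b i else 0) * w Q.1 ≤
        3 ^ n * (2 * (n + 1)) ^ δ * (b i * (R i : ℝ≥0∞) ^ δ) := by
      intro i
      have h2 : ∀ k, ∑' m, (if κ i = k ∧ m ∈ N i then b i else 0) * w k =
          if k = κ i then (N i).card * (b i * w (κ i)) else 0 := by
        intro k
        by_cases hk : k = κ i
        · subst hk
          simp only [true_and, if_true, ite_mul, zero_mul]
          rw [tsum_eq_sum (s := N i) (fun m hm => by simp [hm]), Finset.sum_ite_mem,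
            Finset.inter_self, Finset.sum_const, nsmul_eq_mul]
        · simp [hk, Ne.symm hk]
      rw [ENNReal.tsum_prod']
      simp only [h2]
      rw [tsum_ite_eq]
      by_cases hR : R i = 0
      · simp [hN, hR]
      · have hcard : (N i).card = 3 ^ n := by
          simp only [hN, hR, if_false]
          exact card_dyadicNeighbors _ _
        have hwi : w (κ i) ≤ (2 * (n + 1)) ^ δ * (R i : ℝ≥0∞) ^ δ := by
          rw [← ENNReal.mul_rpow_of_nonneg _ _ hδ.le]
          refine ENNReal.rpow_le_rpow ?_ hδ.le
          have : ((n : ℝ≥0) + 1) * 2 ^ (κ i) ≤ 2 * (n + 1) * R i := by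
            calc ((n : ℝ≥0) + 1) * 2 ^ (κ i) ≤ (n + 1) * (2 * R i) :=
                  mul_le_mul_right (hκ i hR).2 _
              _ = 2 * (n + 1) * R i := by ring
          exact_mod_cast this
        rw [hcard]
        calc ((3 ^ n : ℕ) : ℝ≥0∞) * (b i * w (κ i))
            ≤ ((3 ^ n : ℕ) : ℝ≥0∞) * (b i * ((2 * (n + 1)) ^ δ * (R i : ℝ≥0∞) ^ δ)) := by gcongr
          _ = _ := by push_cast; ring
    calc ∑' Q : ℤ × (Fin n → ℤ), a Q.1 Q.2 * w Q.1
        = ∑' Q : ℤ × (Fin n → ℤ), ∑' i, (if κ i = Q.1 ∧ Q.2 ∈ N i then b i else 0) * w Q.1 := by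
          simp only [ha, ENNReal.tsum_mul_right]
      _ = ∑' i, ∑' Q : ℤ × (Fin n → ℤ), (if κ i = Q.1 ∧ Q.2 ∈ N i then b i else 0) * w Q.1 :=
          ENNReal.tsum_comm
      _ ≤ ∑' i, 3 ^ n * (2 * (n + 1)) ^ δ * (b i * (R i : ℝ≥0∞) ^ δ) := ENNReal.tsum_le_tsum h1
      _ = _ := ENNReal.tsum_mul_left
  · intro 𝒮 h𝒮
    have hcov : {x | (s : ℝ≥0∞) < ∑' i, (Metric.ball (c i) (R i)).indicator (fun _ => b i) x} ⊆
        ⋃ Q : 𝒮, Metric.ball (WithLp.toLp 2 fun j => (2 : ℝ) ^ Q.1.1 * Q.1.2 j)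
          (((n + 1) * 2 ^ Q.1.1 : ℝ≥0) : ℝ) := by
      intro x hx
      have hx' : (s : ℝ≥0∞) < ∑' k, a k (dyadicIndex k x) := by
        refine lt_of_lt_of_le hx ?_
        simp only [ha]
        rw [ENNReal.tsum_comm]
        refine ENNReal.tsum_le_tsum fun i => ?_
        by_cases hxi : x ∈ Metric.ball (c i) (R i)
        · rw [Set.indicator_of_mem hxi]
          refine le_trans ?_ (ENNReal.le_tsum (κ i))
          have hlt := Metric.mem_ball.1 hxi
          have hR : R i ≠ 0 := by
            intro h0
            rw [h0] at hlt
            exact absurd hlt (not_lt.2 (by simp))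
          have hmem : dyadicIndex (κ i) x ∈ N i := by
            simp only [hN, hR, if_false]
            exact dyadicIndex_mem_neighbors (hlt.trans_le (by exact_mod_cast (hκ i hR).1))
          simp [hmem]
        · simp [hxi]
      obtain ⟨k, hk⟩ := h𝒮 hx'
      refine Set.mem_iUnion.2 ⟨⟨_, hk⟩, ?_⟩
      have := mem_ball_of_dyadicIndex_eq (k := k) (x := x) rfl
      push_cast
      exact this
    refine (hausdorffContent_le_tsum hδ _ _ hcov).trans (le_of_eq ?_)
    exact tsum_subtype 𝒮 fun Q => w Q.1

end WeightedContent

/-! ### Weak type bounds for the maximal function -/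

section WeakType

open MeasureTheory

variable {n : ℕ} {δ q : ℝ}

theorem ENNReal.tsum_rpow_le_tsum_rpow {ι : Type*} (f : ι → ℝ≥0∞) (hq : 0 < q) (hq1 : q ≤ 1) :
    (∑' i, f i) ^ q ≤ ∑' i, f i ^ q := by
  classical
  have hfin : ∀ s : Finset ι, (∑ i ∈ s, f i) ^ q ≤ ∑ i ∈ s, f i ^ q := by
    intro s
    induction s using Finset.induction_on with
    | empty => simp [hq]
    | insert i s hi ih =>
      rw [Finset.sum_insert hi, Finset.sum_insert hi]
      exact (ENNReal.rpow_add_le_add_rpow _ _ hq.le hq1).trans (by gcongr)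
  rw [← ENNReal.le_rpow_inv_iff hq, ENNReal.tsum_eq_iSup_sum]
  refine iSup_le fun s => ?_
  rw [ENNReal.le_rpow_inv_iff hq]
  exact (hfin s).trans (ENNReal.sum_le_tsum s)

/-- The set of points lying in some ball over which the average of
`∑ᵢ aᵢ 1_{B(cᵢ, rᵢ)}` exceeds `t`, i.e. the superlevel set at height `t` of the uncentred maximal
function of this sum. -/
def maximalSuperlevel {ι : Type*} (c : ι → EuclideanSpace ℝ (Fin n)) (r : ι → ℝ≥0)
    (a : ι → ℝ≥0∞) (t : ℝ≥0) : Set (EuclideanSpace ℝ (Fin n)) :=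
  {x | ∃ (z : EuclideanSpace ℝ (Fin n)) (ρ : ℝ≥0), x ∈ Metric.ball z ρ ∧
    t * volume (Metric.ball z (ρ : ℝ)) <
      ∑' i, a i * volume (Metric.ball (c i) (r i) ∩ Metric.ball z ρ)}

/-- The maximal function of the indicator of a ball of radius `r` decays like the `-n`-th power of
the distance in units of `r`. The decay is recorded by the sequence of dilated balls. -/
theorem volume_inter_ball_le (hn : 1 ≤ n) (c x z : EuclideanSpace ℝ (Fin n)) (r ρ : ℝ≥0)
    (hx : x ∈ Metric.ball z ρ) :
    volume (Metric.ball c (r : ℝ) ∩ Metric.ball z ρ) ≤ volume (Metric.ball z (ρ : ℝ)) *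
      ∑' m : ℕ, (Metric.ball c ((3 * 2 ^ m * r : ℝ≥0) : ℝ)).indicator
        (fun _ => (2 : ℝ≥0∞) ^ (n : ℝ) * 2 ^ (-(m * n : ℝ))) x := by
  classical
  rcases Set.eq_empty_or_nonempty (Metric.ball c (r : ℝ) ∩ Metric.ball z ρ) with h | ⟨y, hyc, hyz⟩
  · rw [h]; simp
  rw [Metric.mem_ball] at hx hyc hyz
  have hr : (0 : ℝ) < r := dist_nonneg.trans_lt hyc
  have hn0 : (0 : ℝ) ≤ n := Nat.cast_nonneg n
  have hex : ∃ m : ℕ, dist x c < 3 * 2 ^ m * r := by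
    obtain ⟨m, hm⟩ := pow_unbounded_of_one_lt (dist x c / (3 * r)) one_lt_two
    refine ⟨m, ?_⟩
    rw [div_lt_iff₀ (by positivity)] at hm
    linarith
  -- `m` is least with `x` in the dilate of factor `3 * 2 ^ m`; if `m = k + 1`, then a ball
  -- through `x` that meets `B(c, r)` has radius at least `2 ^ k * r`.
  obtain ⟨m, hm, hmin⟩ : ∃ m : ℕ, dist x c < 3 * 2 ^ m * r ∧
      ∀ k < m, ¬ dist x c < 3 * 2 ^ k * r :=
    ⟨Nat.find hex, Nat.find_spec hex, fun k => Nat.find_min hex⟩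
  have hmem : x ∈ Metric.ball c ((3 * 2 ^ m * r : ℝ≥0) : ℝ) := by
    rw [Metric.mem_ball]
    push_cast
    exact hm
  refine le_trans ?_ (mul_le_mul_right (ENNReal.le_tsum m) _)
  rw [Set.indicator_of_mem hmem]
  rcases m with _ | k
  · refine (measure_mono Set.inter_subset_right).trans ?_
    have h1 : (1 : ℝ≥0∞) ≤ 2 ^ (n : ℝ) :=
      ENNReal.one_le_rpow (by norm_num) (by exact_mod_cast hn)
    simp only [Nat.cast_zero, zero_mul, neg_zero, ENNReal.rpow_zero, mul_one]
    exact le_mul_of_one_le_right' h1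
  · have h1 := hmin k (Nat.lt_succ_self k)
    have hkr : (2 : ℝ) ^ k * r ≤ ρ := by
      have h2 : dist x c ≤ dist x z + dist y z + dist y c := by
        have := dist_triangle x z c
        have := dist_triangle z y c
        rw [dist_comm z y] at this
        linarith
      have h3 : (1 : ℝ) ≤ 2 ^ k := one_le_pow₀ one_le_two
      nlinarith
    have hkr' : (2 : ℝ≥0∞) ^ (k : ℝ) * r ≤ ρ := by
      rw [ENNReal.rpow_natCast]
      exact_mod_cast hkr
    refine (measure_mono Set.inter_subset_left).trans ?_
    rw [volume_ball_eq hn, volume_ball_eq hn]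
    have h4 : (r : ℝ≥0∞) ^ (n : ℝ) ≤
        (ρ : ℝ≥0∞) ^ (n : ℝ) * (2 ^ (n : ℝ) * 2 ^ (-((k + 1 : ℕ) * n : ℝ))) := by
      have h5 : (r : ℝ≥0∞) = (2 ^ (k : ℝ) * r) * 2 ^ (-(k : ℝ)) := by
        rw [mul_right_comm, ← ENNReal.rpow_add _ _ two_ne_zero ENNReal.ofNat_ne_top]
        simp
      calc (r : ℝ≥0∞) ^ (n : ℝ) = ((2 ^ (k : ℝ) * r) * 2 ^ (-(k : ℝ))) ^ (n : ℝ) := by rw [← h5]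
        _ ≤ (ρ * 2 ^ (-(k : ℝ))) ^ (n : ℝ) := by gcongr
        _ = (ρ : ℝ≥0∞) ^ (n : ℝ) * 2 ^ (-(k : ℝ) * n) := by
          rw [ENNReal.mul_rpow_of_nonneg _ _ hn0, ENNReal.rpow_mul]
        _ = _ := by
          rw [← ENNReal.rpow_add _ _ two_ne_zero ENNReal.ofNat_ne_top]
          congr 2
          push_cast
          ring
    calc _ ≤ ((ρ : ℝ≥0∞) ^ (n : ℝ) * (2 ^ (n : ℝ) * 2 ^ (-((k + 1 : ℕ) * n : ℝ)))) *
          volume (Metric.ball (0 : EuclideanSpace ℝ (Fin n)) 1) := by gcongr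
      _ = _ := by ring

/-- For `δ / n < q ≤ 1` the `q`-th power of the maximal function of `∑ᵢ aᵢ 1_{Bᵢ}` is dominated
by a weighted sum of indicators of the dilates of the `Bᵢ`; the condition `δ < n q` makes the total
cost of the dilates of one ball comparable to the cost of the ball. -/
theorem exists_weakType_of_lt (hn : 1 ≤ n) (hδ : 0 < δ) (hq : 0 < q) (hq1 : q ≤ 1)
    (hδq : δ < n * q) :
    ∃ C : ℝ≥0∞, C ≠ ∞ ∧ ∀ {ι : Type} [Countable ι] (c : ι → EuclideanSpace ℝ (Fin n))
      (r : ι → ℝ≥0) (a : ι → ℝ≥0∞) (t : ℝ≥0), t ≠ 0 →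
      hausdorffContent n δ (maximalSuperlevel c r a t) * (t : ℝ≥0∞) ^ q ≤
        C * ∑' i, a i ^ q * (r i : ℝ≥0∞) ^ δ := by
  set K : ℝ≥0∞ := 3 ^ n * (2 * (n + 1)) ^ δ with hK
  set D : ℝ≥0∞ := (2 ^ (n : ℝ)) ^ q * 3 ^ δ with hD
  set G : ℝ≥0∞ := (1 - 2 ^ (δ - n * q))⁻¹ with hG
  refine ⟨K * (D * G), ?_, ?_⟩
  · refine ENNReal.mul_ne_top (ENNReal.mul_ne_top (by simp) ?_)
      (ENNReal.mul_ne_top (ENNReal.mul_ne_top ?_ ?_) ?_)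
    · exact ENNReal.rpow_ne_top_of_nonneg hδ.le
        (ENNReal.mul_ne_top (by simp) (by simp))
    · exact ENNReal.rpow_ne_top_of_nonneg hq.le (ENNReal.rpow_ne_top_of_nonneg (by simp) (by simp))
    · exact ENNReal.rpow_ne_top_of_nonneg hδ.le (by simp)
    · rw [hG, ENNReal.inv_ne_top]
      have : (2 : ℝ≥0∞) ^ (δ - n * q) < 1 :=
        ENNReal.rpow_lt_one_of_one_lt_of_neg (by norm_num) (by linarith)
      exact (tsub_pos_of_lt this).ne'
  · intro ι _ c r a t ht
    have hsub : maximalSuperlevel c r a t ⊆ {x | ((t ^ q : ℝ≥0) : ℝ≥0∞) < ∑' j : ι × ℕ,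
        (Metric.ball (c j.1) ((3 * 2 ^ j.2 * r j.1 : ℝ≥0) : ℝ)).indicator
          (fun _ => (a j.1 * (2 ^ (n : ℝ) * 2 ^ (-(j.2 * n : ℝ)))) ^ q) x} := by
      rintro x ⟨z, ρ, hx, hlt⟩
      have hpos : volume (Metric.ball z (ρ : ℝ)) ≠ 0 :=
        (Metric.measure_ball_pos _ _ (dist_nonneg.trans_lt (Metric.mem_ball.1 hx))).ne'
      have hfin : volume (Metric.ball z (ρ : ℝ)) ≠ ∞ := measure_ball_lt_top.ne
      have h1 : (t : ℝ≥0∞) < ∑' j : ι × ℕ,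
          (Metric.ball (c j.1) ((3 * 2 ^ j.2 * r j.1 : ℝ≥0) : ℝ)).indicator
            (fun _ => a j.1 * (2 ^ (n : ℝ) * 2 ^ (-(j.2 * n : ℝ)))) x := by
        rw [← ENNReal.mul_lt_mul_iff_right hpos hfin, mul_comm]
        refine hlt.trans_le ?_
        rw [ENNReal.tsum_prod', ← ENNReal.tsum_mul_left]
        refine ENNReal.tsum_le_tsum fun i => ?_
        refine (mul_le_mul_right (volume_inter_ball_le hn (c i) x z (r i) ρ hx) _).trans
          (le_of_eq ?_)
        rw [mul_left_comm, ← ENNReal.tsum_mul_left]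
        congr 1
        refine tsum_congr fun m => ?_
        exact (Set.indicator_const_mul _ _ _ _).symm
      rw [Set.mem_ofPred_eq, ENNReal.coe_rpow_of_nonneg _ hq.le]
      refine ((ENNReal.rpow_lt_rpow_iff hq).2 h1).trans_le
        ((ENNReal.tsum_rpow_le_tsum_rpow _ hq hq1).trans (le_of_eq (tsum_congr fun j => ?_)))
      by_cases hx : x ∈ Metric.ball (c j.1) ((3 * 2 ^ j.2 * r j.1 : ℝ≥0) : ℝ)
      · simp only [Set.indicator_of_mem hx]
      · simp only [Set.indicator_of_notMem hx, ENNReal.zero_rpow_of_pos hq]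
    have h2 := hausdorffContent_mul_le_tsum (n := n) hδ (fun j : ι × ℕ => c j.1)
      (fun j => 3 * 2 ^ j.2 * r j.1)
      (fun j => (a j.1 * (2 ^ (n : ℝ) * 2 ^ (-(j.2 * n : ℝ)))) ^ q) (t ^ q)
    rw [← ENNReal.coe_rpow_of_nonneg _ hq.le]
    refine (mul_le_mul_left (hausdorffContent_mono hsub) _).trans (h2.trans ?_)
    rw [← hK, mul_assoc K]
    refine mul_le_mul_right (le_of_eq ?_) _
    rw [ENNReal.tsum_prod', ← ENNReal.tsum_mul_left]
    refine tsum_congr fun i => ?_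
    have h3 : ∀ m : ℕ, (a i * (2 ^ (n : ℝ) * 2 ^ (-(m * n : ℝ)))) ^ q *
        ((3 * 2 ^ m * r i : ℝ≥0) : ℝ≥0∞) ^ δ =
        D * (a i ^ q * (r i : ℝ≥0∞) ^ δ) * (2 ^ (δ - n * q)) ^ m := by
      intro m
      have h4 : ((2 : ℝ≥0∞) ^ (-(m * n : ℝ))) ^ q * (2 ^ m) ^ δ = (2 ^ (δ - n * q)) ^ m := by
        rw [← ENNReal.rpow_natCast 2 m, ← ENNReal.rpow_natCast _ m, ← ENNReal.rpow_mul,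
          ← ENNReal.rpow_mul, ← ENNReal.rpow_mul,
          ← ENNReal.rpow_add _ _ two_ne_zero ENNReal.ofNat_ne_top]
        congr 1
        ring
      rw [← h4, hD]
      push_cast
      simp only [ENNReal.mul_rpow_of_nonneg _ _ hq.le, ENNReal.mul_rpow_of_nonneg _ _ hδ.le]
      ring
    simp only [h3]
    rw [ENNReal.tsum_mul_left, ENNReal.tsum_geometric]
    ring

/-- The endpoint `δ = n`, `q = 1`, by the Vitali covering lemma. -/
theorem exists_weakType_one (hn : 1 ≤ n) :
    ∃ C : ℝ≥0∞, C ≠ ∞ ∧ ∀ {ι : Type} [Countable ι] (c : ι → EuclideanSpace ℝ (Fin n))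
      (r : ι → ℝ≥0) (a : ι → ℝ≥0∞) (t : ℝ≥0), t ≠ 0 →
      hausdorffContent n n (maximalSuperlevel c r a t) * (t : ℝ≥0∞) ^ (1 : ℝ) ≤
        C * ∑' i, a i ^ (1 : ℝ) * (r i : ℝ≥0∞) ^ (n : ℝ) := by
  have hn0 : (0 : ℝ) < n := by exact_mod_cast hn
  refine ⟨6 ^ (n : ℝ), ENNReal.rpow_ne_top_of_nonneg hn0.le (by simp), ?_⟩
  intro ι _ c r a t ht
  simp only [ENNReal.rpow_one]
  set ω := volume (Metric.ball (0 : EuclideanSpace ℝ (Fin n)) 1) with hω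
  have hω0 : ω ≠ 0 := volume_unitBall_ne_zero
  have hωt : ω ≠ ∞ := volume_unitBall_ne_top
  have ht0 : (t : ℝ≥0∞) ≠ 0 := by exact_mod_cast ht
  set A := ∑' i, a i * (r i : ℝ≥0∞) ^ (n : ℝ) with hA
  by_cases hAt : A = ∞
  · rw [hAt, ENNReal.mul_top]
    · exact le_top
    · exact (ENNReal.rpow_pos (by simp) (by simp)).ne'
  set 𝒯 : Set (EuclideanSpace ℝ (Fin n) × ℝ≥0) := {b | 0 < b.2 ∧
    t * volume (Metric.ball b.1 (b.2 : ℝ)) <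
      ∑' i, a i * volume (Metric.ball (c i) (r i) ∩ Metric.ball b.1 b.2)} with h𝒯
  have hAω : ∑' i, a i * volume (Metric.ball (c i) (r i : ℝ)) = A * ω := by
    rw [hA, ← ENNReal.tsum_mul_right]
    refine tsum_congr fun i => ?_
    rw [volume_ball_eq hn, mul_assoc]
  -- Balls with large average have bounded radii, as the Vitali covering lemma requires.
  have hbdd : ∀ b ∈ 𝒯, (b.2 : ℝ) ≤ ((A / t) ^ (n : ℝ)⁻¹).toReal := by
    rintro ⟨z, ρ⟩ ⟨-, hb⟩
    have h1 : t * volume (Metric.ball z (ρ : ℝ)) ≤ A * ω := by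
      rw [← hAω]
      refine hb.le.trans (ENNReal.tsum_le_tsum fun i => ?_)
      gcongr
      exact Set.inter_subset_left
    rw [volume_ball_eq hn, ← hω, ← mul_assoc, ENNReal.mul_le_mul_iff_left hω0 hωt] at h1
    have h2 : (ρ : ℝ≥0∞) ≤ (A / t) ^ (n : ℝ)⁻¹ := by
      rw [ENNReal.le_rpow_inv_iff hn0, ENNReal.le_div_iff_mul_le (Or.inl ht0) (Or.inl (by simp)),
        mul_comm]
      exact h1
    have h3 : (A / t) ^ (n : ℝ)⁻¹ ≠ ∞ :=
      ENNReal.rpow_ne_top_of_nonneg (by positivity) (ENNReal.div_ne_top hAt ht0)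
    simpa using ENNReal.toReal_mono h3 h2
  obtain ⟨u, hu𝒯, hdisj, hcov⟩ := Vitali.exists_disjoint_subfamily_covering_enlargement_closedBall
    𝒯 (fun b => b.1) (fun b => (b.2 : ℝ)) _ hbdd 5 (by norm_num)
  have hdisj' : u.PairwiseDisjoint fun b => Metric.ball b.1 (b.2 : ℝ) :=
    hdisj.mono fun b => Metric.ball_subset_closedBall
  have huc : u.Countable := hdisj'.countable_of_isOpen (fun b _ => Metric.isOpen_ball)
    fun b hb => Metric.nonempty_ball.2 (by exact_mod_cast (hu𝒯 hb).1)
  have := huc.to_subtype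
  have hsub : maximalSuperlevel c r a t ⊆
      ⋃ b : u, Metric.ball b.1.1 ((6 * b.1.2 : ℝ≥0) : ℝ) := by
    rintro x ⟨z, ρ, hx, hlt⟩
    have hρ : (0 : ℝ) < ρ := dist_nonneg.trans_lt (Metric.mem_ball.1 hx)
    obtain ⟨b, hb, hsub⟩ := hcov (z, ρ) ⟨by exact_mod_cast hρ, hlt⟩
    refine Set.mem_iUnion.2 ⟨⟨b, hb⟩, ?_⟩
    have h1 := Metric.mem_closedBall.1 (hsub (Metric.ball_subset_closedBall hx))
    have h2 : (0 : ℝ) < b.2 := by exact_mod_cast (hu𝒯 hb).1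
    rw [Metric.mem_ball]
    push_cast
    linarith
  have h1 : ∑' b : u, t * volume (Metric.ball b.1.1 (b.1.2 : ℝ)) ≤ A * ω := by
    rw [← hAω]
    calc ∑' b : u, t * volume (Metric.ball b.1.1 (b.1.2 : ℝ))
        ≤ ∑' b : u, ∑' i, a i * volume (Metric.ball (c i) (r i) ∩ Metric.ball b.1.1 b.1.2) :=
          ENNReal.tsum_le_tsum fun b => (hu𝒯 b.2).2.le
      _ = ∑' i, ∑' b : u, a i * volume (Metric.ball (c i) (r i) ∩ Metric.ball b.1.1 b.1.2) :=
          ENNReal.tsum_comm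
      _ ≤ ∑' i, a i * volume (Metric.ball (c i) (r i : ℝ)) := by
          refine ENNReal.tsum_le_tsum fun i => ?_
          rw [ENNReal.tsum_mul_left, ← measure_iUnion]
          · gcongr
            exact Set.iUnion_subset fun b => Set.inter_subset_left
          · intro b b' hbb
            exact (hdisj' b.2 b'.2 (fun h => hbb (Subtype.ext h))).mono
              Set.inter_subset_right Set.inter_subset_right
          · exact fun b => measurableSet_ball.inter measurableSet_ball
  rw [← ENNReal.mul_le_mul_iff_left hω0 hωt]
  calc hausdorffContent n n (maximalSuperlevel c r a t) * t * ω
      ≤ (∑' b : u, ((6 * b.1.2 : ℝ≥0) : ℝ≥0∞) ^ (n : ℝ)) * t * ω := by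
        gcongr
        exact hausdorffContent_le_tsum hn0 _ _ hsub
    _ = 6 ^ (n : ℝ) * ∑' b : u, t * volume (Metric.ball b.1.1 (b.1.2 : ℝ)) := by
        rw [← ENNReal.tsum_mul_right, ← ENNReal.tsum_mul_right, ← ENNReal.tsum_mul_left]
        refine tsum_congr fun b => ?_
        rw [volume_ball_eq hn, ← hω]
        push_cast
        rw [ENNReal.mul_rpow_of_nonneg _ _ hn0.le]
        ring
    _ ≤ 6 ^ (n : ℝ) * (A * ω) := by gcongr
    _ = _ := by rw [mul_assoc]

end WeakType

/-! ### The sharp maximal function -/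

section SharpFunction

open MeasureTheory

variable {n : ℕ}

theorem lintegral_measure_lt_le {α : Type*} [MeasurableSpace α] (μ : Measure α) {Φ : α → ℝ≥0∞}
    (hΦ : Measurable Φ) :
    ∫⁻ t in Set.Ioi (0 : ℝ), μ {x | ENNReal.ofReal t < Φ x} ≤ ∫⁻ x, Φ x ∂μ := by
  by_cases hfin : ∫⁻ x, Φ x ∂μ = ∞
  · rw [hfin]; exact le_top
  have hlt : ∀ᵐ x ∂μ, Φ x < ∞ := ae_lt_top hΦ hfin
  have h1 : ∫⁻ x, Φ x ∂μ = ∫⁻ x, ENNReal.ofReal (Φ x).toReal ∂μ :=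
    lintegral_congr_ae (hlt.mono fun x hx => (ENNReal.ofReal_toReal hx.ne).symm)
  rw [h1, lintegral_eq_lintegral_meas_lt μ (Filter.Eventually.of_forall fun x => by simp)
    hΦ.ennreal_toReal.aemeasurable]
  refine setLIntegral_mono' measurableSet_Ioi fun t ht => measure_mono_ae ?_
  filter_upwards [hlt] with x hx htx
  exact (ENNReal.ofReal_lt_iff_lt_toReal (le_of_lt ht) hx.ne).1 htx

/-- For a measurable majorant `Φ`, the `n`-dimensional Choquet integral of an arbitrary function is
controlled by a Lebesgue integral. -/
theorem choquetIntegral_le_lintegral (hn : 1 ≤ n) {B : Set (EuclideanSpace ℝ (Fin n))}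
    {g Φ : EuclideanSpace ℝ (Fin n) → ℝ≥0∞} (hΦ : Measurable Φ)
    (h : ∀ y, g y ≤ Φ y) :
    choquetIntegral (hausdorffContent n n) B g ≤
      2 ^ (n : ℝ) / volume (Metric.ball (0 : EuclideanSpace ℝ (Fin n)) 1) * ∫⁻ y in B, Φ y := by
  set κ := 2 ^ (n : ℝ) / volume (Metric.ball (0 : EuclideanSpace ℝ (Fin n)) 1) with hκ
  have hκt : κ ≠ ∞ := ENNReal.div_ne_top (by simp) volume_unitBall_ne_zero
  refine le_trans ?_ (mul_le_mul_right (lintegral_measure_lt_le (volume.restrict B) hΦ) κ)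
  rw [← lintegral_const_mul' _ _ hκt, choquetIntegral]
  refine lintegral_mono fun t => ?_
  refine (hausdorffContent_le_volume hn _).trans ?_
  rw [← hκ, Measure.restrict_apply (measurableSet_lt measurable_const hΦ)]
  refine mul_le_mul_right (measure_mono ?_) _
  rintro x ⟨hxB, hx⟩
  exact ⟨hx.trans_le (h x), hxB⟩

/-- This holds for infinite `a` and `c` too: the convention `⊤ - ⊤ = ⊥` makes the left side infinite
only where the right side is. -/
theorem EReal.abs_sub_coe_ennreal_le (a : EReal) (c : ℝ≥0∞) :
    (a - (c : EReal)).abs ≤ a.abs + c := by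
  induction c using ENNReal.recTopCoe with
  | top => simp
  | coe c =>
    induction a with
    | bot => simp
    | top => simp
    | coe a =>
      have : ((a : EReal) - ((c : ℝ≥0∞) : EReal)) = ((a - c : ℝ) : EReal) := by
        rw [EReal.coe_sub]
        rfl
      rw [this, EReal.abs_def, EReal.abs_def, ← ENNReal.ofReal_coe_nnreal,
        ← ENNReal.ofReal_add (abs_nonneg _) c.coe_nonneg]
      refine ENNReal.ofReal_le_ofReal ((abs_sub _ _).trans ?_)
      rw [abs_of_nonneg c.coe_nonneg]

/-- If `|f|` is at most `τ` plus a weighted sum of indicators of balls, then the sharp function of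
`f` is at most a constant times `τ` wherever the maximal function of the sum is at most `τ`. -/
theorem sharpMaximalFunction_le (hn : 1 ≤ n) {ι : Type} [Countable ι]
    (c : ι → EuclideanSpace ℝ (Fin n)) (r : ι → ℝ≥0) (a : ι → ℝ≥0∞) (τ : ℝ≥0)
    {f : EuclideanSpace ℝ (Fin n) → EReal}
    (hf : ∀ y, (f y).abs ≤ τ + ∑' i, (Metric.ball (c i) (r i)).indicator (fun _ => a i) y)
    {x : EuclideanSpace ℝ (Fin n)} (hx : x ∉ maximalSuperlevel c r a τ) :
    sharpMaximalFunction n n f x ≤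
      2 ^ (n : ℝ) * (2 + 2 ^ (n : ℝ) * 2) * τ := by
  refine iSup_le fun z => iSup_le fun ρ => iSup_le fun hxB => ?_
  have hρ : 0 < ρ := dist_nonneg.trans_lt (Metric.mem_ball.1 hxB)
  lift ρ to ℝ≥0 using hρ.le
  set B := Metric.ball z (ρ : ℝ) with hB
  set ω := volume (Metric.ball (0 : EuclideanSpace ℝ (Fin n)) 1) with hω
  have hω0 : ω ≠ 0 := volume_unitBall_ne_zero
  have hωt : ω ≠ ∞ := volume_unitBall_ne_top
  -- A measurable majorant of `|f|`, which itself need not be measurable.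
  set Φ : EuclideanSpace ℝ (Fin n) → ℝ≥0∞ := fun y =>
    τ + ∑' i, (Metric.ball (c i) (r i)).indicator (fun _ => a i) y with hΦ
  have hΦs : Measurable fun y => ∑' i, (Metric.ball (c i) (r i)).indicator (fun _ => a i) y :=
    Measurable.tsum fun i => measurable_const.indicator measurableSet_ball
  have hΦm : Measurable Φ := measurable_const.add hΦs
  have hint : ∫⁻ y in B, Φ y ≤ 2 * τ * volume B := by
    rw [hΦ, lintegral_add_left measurable_const, lintegral_tsum fun i =>
      (measurable_const.indicator measurableSet_ball).aemeasurable]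
    simp only [lintegral_indicator_const measurableSet_ball, lintegral_const,
      Measure.restrict_apply measurableSet_ball, Measure.restrict_apply MeasurableSet.univ,
      Set.univ_inter]
    have : ∑' i, a i * volume (Metric.ball (c i) (r i) ∩ B) ≤ τ * volume B := by
      by_contra! hlt
      exact hx ⟨z, ρ, hxB, hlt⟩
    calc _ ≤ τ * volume B + τ * volume B := by gcongr
      _ = _ := by ring
  -- Averages with respect to the content are comparable to averages with respect to volume.
  have havg : ∀ X : ℝ≥0∞, (hausdorffContent n n B)⁻¹ * (2 ^ (n : ℝ) / ω * (X * volume B)) ≤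
      2 ^ (n : ℝ) * X := by
    intro X
    have h1 : volume B ≤ hausdorffContent n n B * ω := volume_le_hausdorffContent hn B
    calc (hausdorffContent n n B)⁻¹ * (2 ^ (n : ℝ) / ω * (X * volume B))
        ≤ (hausdorffContent n n B)⁻¹ * (2 ^ (n : ℝ) / ω * (X * (hausdorffContent n n B * ω))) := by
          gcongr
      _ = ((hausdorffContent n n B)⁻¹ * hausdorffContent n n B) * (2 ^ (n : ℝ) / ω * ω * X) := by
          ring
      _ ≤ 1 * (2 ^ (n : ℝ) / ω * ω * X) := by
          gcongr
          exact ENNReal.inv_mul_le_one _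
      _ = 2 ^ (n : ℝ) * X := by rw [one_mul, ENNReal.div_mul_cancel hω0 hωt]
  have hfB : contentAverage n n f B ≤ 2 ^ (n : ℝ) * (2 * τ) := by
    refine le_trans ?_ (havg _)
    rw [contentAverage]
    gcongr
    exact (choquetIntegral_le_lintegral hn hΦm hf).trans (mul_le_mul_right hint _)
  have hdiff : ∀ y, (f y - (contentAverage n n f B : EReal)).abs ≤
      Φ y + 2 ^ (n : ℝ) * (2 * τ) := fun y =>
    (EReal.abs_sub_coe_ennreal_le _ _).trans (add_le_add (hf y) hfB)
  have hint' : ∫⁻ y in B, (Φ y + 2 ^ (n : ℝ) * (2 * τ)) ≤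
      (2 + 2 ^ (n : ℝ) * 2) * τ * volume B := by
    rw [lintegral_add_left hΦm, setLIntegral_const]
    calc _ ≤ 2 * τ * volume B + 2 ^ (n : ℝ) * (2 * τ) * volume B := by gcongr
      _ = _ := by ring
  rw [mul_assoc]
  refine le_trans ?_ (havg _)
  gcongr
  exact (choquetIntegral_le_lintegral hn (hΦm.add_const _) hdiff).trans
    (mul_le_mul_right hint' _)

end SharpFunction

/-! ### Dyadic levels and summation of the weak type bounds -/

section Discretization

open MeasureTheory

variable {X : Type*} {p : ℝ}

theorem Real.monotone_two_rpow_intCast_mul (hp : 0 < p) :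
    Monotone fun l : ℤ => (2 : ℝ) ^ ((l : ℝ) * p) := by
  intro k l hkl
  have : (k : ℝ) ≤ l := by exact_mod_cast hkl
  exact Real.rpow_le_rpow_of_exponent_le one_le_two (by gcongr)

theorem Real.iUnion_Ioc_two_rpow (hp : 0 < p) :
    ⋃ l : ℤ, Set.Ioc ((2 : ℝ) ^ ((l : ℝ) * p)) (2 ^ (((l + 1 : ℤ) : ℝ) * p)) = Set.Ioi 0 := by
  ext s
  rw [Set.mem_iUnion, Set.mem_Ioi]
  constructor
  · rintro ⟨l, hl, -⟩
    exact (Real.rpow_pos_of_pos two_pos _).trans hl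
  · intro hs
    obtain ⟨l, hl⟩ := exists_mem_Ioc_zpow hs (Real.one_lt_rpow one_lt_two hp)
    refine ⟨l, ?_⟩
    rw [mul_comm, mul_comm (((l + 1 : ℤ) : ℝ)), Real.rpow_mul zero_le_two,
      Real.rpow_mul zero_le_two, Real.rpow_intCast, Real.rpow_intCast]
    exact hl

theorem ENNReal.ofReal_two_rpow (x : ℝ) : ENNReal.ofReal ((2 : ℝ) ^ x) = 2 ^ x := by
  rw [← ENNReal.ofReal_rpow_of_pos two_pos]
  simp

theorem ENNReal.two_rpow_lt_iff (hp : 0 < p) (x : ℝ) (y : ℝ≥0∞) :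
    (2 : ℝ≥0∞) ^ (x * p) < y ^ p ↔ 2 ^ x < y := by
  rw [ENNReal.rpow_mul, ENNReal.rpow_lt_rpow_iff hp]

/-- The Choquet integral split over the intervals `(2 ^ (l p), 2 ^ ((l + 1) p)]`, which correspond
to the values of `g` between `2 ^ l` and `2 ^ (l + 1)`. -/
theorem choquetIntegral_rpow_eq_tsum (H : Set X → ℝ≥0∞) (g : X → ℝ≥0∞) (hp : 0 < p) :
    choquetIntegral H Set.univ (fun x => g x ^ p) =
      ∑' l : ℤ, ∫⁻ s in Set.Ioc ((2 : ℝ) ^ ((l : ℝ) * p)) (2 ^ (((l + 1 : ℤ) : ℝ) * p)),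
        H {x | ENNReal.ofReal s < g x ^ p} := by
  have hdisj : Pairwise (Function.onFun Disjoint fun l : ℤ =>
      Set.Ioc ((2 : ℝ) ^ ((l : ℝ) * p)) (2 ^ (((l + 1 : ℤ) : ℝ) * p))) :=
    (Real.monotone_two_rpow_intCast_mul hp).pairwise_disjoint_on_Ioc_succ
  rw [choquetIntegral, ← Real.iUnion_Ioc_two_rpow hp,
    lintegral_iUnion (fun l => measurableSet_Ioc) hdisj]
  simp

theorem choquetIntegral_rpow_le_tsum {H : Set X → ℝ≥0∞} (hH : Monotone H) (g : X → ℝ≥0∞)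
    (hp : 0 < p) :
    choquetIntegral H Set.univ (fun x => g x ^ p) ≤
      2 ^ p * ∑' l : ℤ, 2 ^ ((l : ℝ) * p) * H {x | 2 ^ (l : ℝ) < g x} := by
  rw [choquetIntegral_rpow_eq_tsum H g hp, ← ENNReal.tsum_mul_left]
  refine ENNReal.tsum_le_tsum fun l => ?_
  have h1 : ∀ s ∈ Set.Ioc ((2 : ℝ) ^ ((l : ℝ) * p)) (2 ^ (((l + 1 : ℤ) : ℝ) * p)),
      H {x | ENNReal.ofReal s < g x ^ p} ≤ H {x | 2 ^ (l : ℝ) < g x} := by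
    intro s hs
    refine hH fun x hx => ?_
    rw [Set.mem_ofPred_eq, ← ENNReal.two_rpow_lt_iff hp, ← ENNReal.ofReal_two_rpow]
    exact (ENNReal.ofReal_le_ofReal hs.1.le).trans_lt hx
  refine (setLIntegral_mono' measurableSet_Ioc h1).trans ?_
  rw [setLIntegral_const, Real.volume_Ioc, mul_comm, ← mul_assoc]
  gcongr
  refine (ENNReal.ofReal_le_ofReal (sub_le_self _ (Real.rpow_nonneg zero_le_two _))).trans
    (le_of_eq ?_)
  rw [ENNReal.ofReal_two_rpow, ← ENNReal.rpow_add _ _ two_ne_zero ENNReal.ofNat_ne_top]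
  congr 1
  push_cast
  ring

theorem tsum_le_choquetIntegral_rpow {H : Set X → ℝ≥0∞} (hH : Monotone H) (g : X → ℝ≥0∞)
    (hp : 0 < p) :
    ∑' l : ℤ, 2 ^ ((l : ℝ) * p) * H {x | 2 ^ (l : ℝ) < g x} ≤
      (1 - 2 ^ (-p))⁻¹ * choquetIntegral H Set.univ (fun x => g x ^ p) := by
  have hlt : (2 : ℝ≥0∞) ^ (-p) < 1 :=
    ENNReal.rpow_lt_one_of_one_lt_of_neg (by norm_num) (by linarith)
  have hc0 : 1 - (2 : ℝ≥0∞) ^ (-p) ≠ 0 := (tsub_pos_of_lt hlt).ne'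
  have hct : 1 - (2 : ℝ≥0∞) ^ (-p) ≠ ∞ := (tsub_le_self.trans_lt ENNReal.one_lt_top).ne
  rw [← ENNReal.div_eq_inv_mul, ENNReal.le_div_iff_mul_le (Or.inl hc0) (Or.inl hct),
    choquetIntegral_rpow_eq_tsum H g hp, ← (Equiv.addRight (1 : ℤ)).tsum_eq,
    ← ENNReal.tsum_mul_right]
  refine ENNReal.tsum_le_tsum fun l => ?_
  rw [Equiv.coe_addRight]
  have h1 : ∀ s ∈ Set.Ioc ((2 : ℝ) ^ ((l : ℝ) * p)) (2 ^ (((l + 1 : ℤ) : ℝ) * p)),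
      H {x | 2 ^ ((l + 1 : ℤ) : ℝ) < g x} ≤ H {x | ENNReal.ofReal s < g x ^ p} := by
    intro s hs
    refine hH fun x hx => ?_
    rw [Set.mem_ofPred_eq, ← ENNReal.two_rpow_lt_iff hp, ← ENNReal.ofReal_two_rpow] at hx
    exact (ENNReal.ofReal_le_ofReal hs.2).trans_lt hx
  refine le_trans (le_of_eq ?_) (setLIntegral_mono' measurableSet_Ioc h1)
  rw [setLIntegral_const, Real.volume_Ioc, mul_right_comm, mul_comm _ (H _)]
  congr 1
  have h2 : (2 : ℝ) ^ ((l : ℝ) * p) = 2 ^ (((l + 1 : ℤ) : ℝ) * p) * 2 ^ (-p) := by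
    rw [← Real.rpow_add two_pos]
    congr 1
    push_cast
    ring
  rw [h2, ENNReal.ofReal_sub _ (by positivity), ENNReal.ofReal_mul (by positivity),
    ENNReal.ofReal_two_rpow, ENNReal.ofReal_two_rpow, ENNReal.mul_sub, mul_one]
  intro _ _
  exact ENNReal.rpow_ne_top_of_ne_zero two_ne_zero ENNReal.ofNat_ne_top

end Discretization

section Interpolation

open MeasureTheory

variable {n : ℕ} {δ p : ℝ}

/-- A maximal weak type bound of some exponent `q < p`: `q` lies in `(δ / n, 1]` if `δ < n`, and
`q = 1` if `δ = n`. -/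
theorem exists_weakType (hn : 1 ≤ n) (hδ : 0 < δ) (hδn : δ ≤ n) (hp : δ / n < p) :
    ∃ q < p, ∃ C : ℝ≥0∞, C ≠ ∞ ∧
      ∀ {ι : Type} [Countable ι] (c : ι → EuclideanSpace ℝ (Fin n))
      (r : ι → ℝ≥0) (a : ι → ℝ≥0∞) (t : ℝ≥0), t ≠ 0 →
      hausdorffContent n δ (maximalSuperlevel c r a t) * (t : ℝ≥0∞) ^ q ≤
        C * ∑' i, a i ^ q * (r i : ℝ≥0∞) ^ δ := by
  have hn0 : (0 : ℝ) < n := by exact_mod_cast hn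
  rcases hδn.eq_or_lt with rfl | hlt
  · rw [div_self hn0.ne'] at hp
    exact ⟨1, hp, exists_weakType_one hn⟩
  · obtain ⟨q, hq, hq'⟩ := exists_between (lt_min hp ((div_lt_one hn0).2 hlt))
    have hq0 : 0 < q := (div_pos hδ hn0).trans hq
    refine ⟨q, hq'.trans_le (min_le_left _ _), exists_weakType_of_lt hn hδ hq0
      (hq'.le.trans (min_le_right _ _)) ?_⟩
    rw [div_lt_iff₀ hn0] at hq
    linarith

/-- A function is at most `2 ^ k` plus the layers of height `2 ^ (k + j + 1)` carried by its
superlevel sets `{g > 2 ^ (k + j)}`, hence carried by covers of these sets. -/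
theorem le_two_rpow_add_tsum_layers {X : Type*} {g : X → ℝ≥0∞} {U : ℤ → ℕ → Set X}
    (hU : ∀ l : ℤ, {x | 2 ^ (l : ℝ) < g x} ⊆ ⋃ i, U l i) (k : ℤ) (y : X) :
    g y ≤ 2 ^ (k : ℝ) + ∑' j : ℕ × ℕ,
      (U (k + j.1) j.2).indicator (fun _ => (2 : ℝ≥0∞) ^ ((k + j.1 + 1 : ℤ) : ℝ)) y := by
  rcases le_or_gt (g y) (2 ^ (k : ℝ)) with h | h
  · exact h.trans le_self_add
  have hterm : ∀ j : ℕ, 2 ^ ((k + j : ℤ) : ℝ) < g y → (2 : ℝ≥0∞) ^ ((k + j + 1 : ℤ) : ℝ) ≤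
      ∑' i : ℕ, (U (k + j) i).indicator (fun _ => (2 : ℝ≥0∞) ^ ((k + j + 1 : ℤ) : ℝ)) y := by
    intro j hj
    obtain ⟨i, hi⟩ := Set.mem_iUnion.1 (hU (k + j) hj)
    refine le_trans (le_of_eq ?_) (ENNReal.le_tsum i)
    rw [Set.indicator_of_mem hi]
  refine le_trans ?_ le_add_self
  rw [ENNReal.tsum_prod']
  -- Where `g` is infinite, every layer contributes at least `2 ^ k` and the sum diverges.
  by_cases htop : g y = ∞
  · have h1 : ∀ j : ℕ, (2 : ℝ≥0∞) ^ (k : ℝ) ≤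
        ∑' i : ℕ, (U (k + j) i).indicator (fun _ => (2 : ℝ≥0∞) ^ ((k + j + 1 : ℤ) : ℝ)) y := by
      intro j
      refine le_trans ?_ (hterm j ?_)
      · refine ENNReal.rpow_le_rpow_of_exponent_le (by norm_num) ?_
        push_cast
        linarith [(Nat.cast_nonneg j : (0 : ℝ) ≤ j)]
      · rw [htop]
        exact (ENNReal.rpow_ne_top_of_ne_zero two_ne_zero ENNReal.ofNat_ne_top).lt_top
    refine le_trans ?_ (ENNReal.tsum_le_tsum h1)
    rw [ENNReal.tsum_const_eq_top_of_ne_zero (ENNReal.rpow_pos (by simp) (by simp)).ne']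
    exact le_top
  · obtain ⟨m, hm1, hm2⟩ := ENNReal.exists_mem_Ioc_zpow (y := 2) (ne_bot_of_gt h) htop (by norm_num)
      ENNReal.ofNat_ne_top
    have hkm : k ≤ m := by
      by_contra! hlt
      have : (2 : ℝ≥0∞) ^ (m + 1) ≤ 2 ^ k := ENNReal.zpow_le_of_le one_le_two hlt
      rw [ENNReal.rpow_intCast] at h
      exact absurd (hm2.trans this) (not_le.2 h)
    obtain ⟨j, rfl⟩ := Int.le.dest hkm
    refine le_trans ?_ (ENNReal.le_tsum j)
    refine le_trans ?_ (hterm j ?_)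
    · rw [ENNReal.rpow_intCast]
      exact hm2
    · rw [ENNReal.rpow_intCast]
      exact hm1

/-- Summation of the weak type bounds: with `q < p`, the layer `j` steps above the level `2 ^ k`
contributes with the factor `2 ^ (j (q - p))`, so that the layers sum to a geometric series. -/
theorem tsum_hausdorffContent_maximalSuperlevel_le {q : ℝ} {C : ℝ≥0∞}
    (hC : ∀ {ι : Type} [Countable ι] (c : ι → EuclideanSpace ℝ (Fin n))
      (r : ι → ℝ≥0) (a : ι → ℝ≥0∞) (t : ℝ≥0), t ≠ 0 →
      hausdorffContent n δ (maximalSuperlevel c r a t) * (t : ℝ≥0∞) ^ q ≤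
        C * ∑' i, a i ^ q * (r i : ℝ≥0∞) ^ δ)
    (c : ℤ → ℕ → EuclideanSpace ℝ (Fin n)) (r : ℤ → ℕ → ℝ≥0) :
    ∑' k : ℤ, 2 ^ ((k : ℝ) * p) * hausdorffContent n δ (maximalSuperlevel
        (fun j : ℕ × ℕ => c (k + j.1) j.2) (fun j => r (k + j.1) j.2)
        (fun j => 2 ^ ((k + j.1 + 1 : ℤ) : ℝ)) (2 ^ (k : ℝ))) ≤
      C * 2 ^ q * (1 - 2 ^ (q - p))⁻¹ *
        ∑' l : ℤ, 2 ^ ((l : ℝ) * p) * ∑' i, (r l i : ℝ≥0∞) ^ δ := by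
  have hadd : ∀ x y : ℝ, (2 : ℝ≥0∞) ^ (x + y) = 2 ^ x * 2 ^ y := fun x y =>
    ENNReal.rpow_add _ _ two_ne_zero ENNReal.ofNat_ne_top
  set b : ℤ → ℝ≥0∞ := fun l => 2 ^ ((l : ℝ) * p) * ∑' i, (r l i : ℝ≥0∞) ^ δ with hb
  have h1 : ∀ k : ℤ, 2 ^ ((k : ℝ) * p) * hausdorffContent n δ (maximalSuperlevel
        (fun j : ℕ × ℕ => c (k + j.1) j.2) (fun j => r (k + j.1) j.2)
        (fun j => 2 ^ ((k + j.1 + 1 : ℤ) : ℝ)) (2 ^ (k : ℝ))) ≤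
      C * 2 ^ q * ∑' j : ℕ, (2 ^ (q - p)) ^ j * b (k + j) := by
    intro k
    have h2 := hC (fun j : ℕ × ℕ => c (k + j.1) j.2) (fun j => r (k + j.1) j.2)
      (fun j => 2 ^ ((k + j.1 + 1 : ℤ) : ℝ)) (2 ^ (k : ℝ))
      (NNReal.rpow_pos two_pos).ne'
    rw [ENNReal.coe_rpow_of_ne_zero two_ne_zero, ENNReal.coe_ofNat, ← ENNReal.rpow_mul] at h2
    have h3 : (2 : ℝ≥0∞) ^ ((k : ℝ) * p) = 2 ^ ((k : ℝ) * (p - q)) * 2 ^ ((k : ℝ) * q) := by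
      rw [← hadd]; congr 1; ring
    rw [h3, mul_assoc, mul_comm (2 ^ ((k : ℝ) * q))]
    refine (mul_le_mul_right h2 _).trans (le_of_eq ?_)
    rw [mul_left_comm, mul_assoc, ENNReal.tsum_prod',
      ← ENNReal.tsum_mul_left (a := 2 ^ ((k : ℝ) * (p - q))),
      ← ENNReal.tsum_mul_left (a := 2 ^ q)]
    congr 1
    refine tsum_congr fun j => ?_
    simp only [hb]
    rw [ENNReal.tsum_mul_left, ← mul_assoc, ← mul_assoc, ← mul_assoc]
    congr 1
    rw [← ENNReal.rpow_natCast, ← ENNReal.rpow_mul, ← ENNReal.rpow_mul, ← hadd, ← hadd, ← hadd]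
    congr 1
    push_cast
    ring
  refine (ENNReal.tsum_le_tsum h1).trans (le_of_eq ?_)
  rw [ENNReal.tsum_mul_left, ENNReal.tsum_comm, mul_assoc (C * 2 ^ q)]
  congr 1
  rw [← ENNReal.tsum_geometric, ← ENNReal.tsum_mul_right]
  refine tsum_congr fun j => ?_
  rw [ENNReal.tsum_mul_left]
  congr 1
  exact (Equiv.addRight (j : ℤ)).tsum_eq b

end Interpolation

theorem mainTheorem11 (n : ℕ) (hn : 1 ≤ n) (δ : ℝ) (hδ : 0 < δ) (hδn : δ ≤ n)
    (p : ℝ) (hp : δ / n < p) :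
    ∃ c : ℝ≥0, ∀ f ∈ NLp n p δ,
      choquetIntegral (hausdorffContent n δ) Set.univ
          (fun x => sharpMaximalFunction n (n : ℝ) f x ^ p) ≤
        c * choquetIntegral (hausdorffContent n δ) Set.univ (fun x => (f x).abs ^ p) := by
  have hp0 : 0 < p := (div_nonneg hδ.le (Nat.cast_nonneg n)).trans_lt hp
  have hmono : Monotone (hausdorffContent n δ) := fun _ _ => hausdorffContent_mono
  have h2t : ∀ x : ℝ, (2 : ℝ≥0∞) ^ x ≠ ∞ := fun x =>
    ENNReal.rpow_ne_top_of_ne_zero two_ne_zero ENNReal.ofNat_ne_top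
  have h20 : ∀ x : ℝ, (2 : ℝ≥0∞) ^ x ≠ 0 := fun x => (ENNReal.rpow_pos (by simp) (by simp)).ne'
  have hgeom : ∀ x : ℝ, x < 0 → (1 - (2 : ℝ≥0∞) ^ x)⁻¹ ≠ ∞ := fun x hx =>
    ENNReal.inv_ne_top.2 (tsub_pos_of_lt
      (ENNReal.rpow_lt_one_of_one_lt_of_neg (by norm_num) hx)).ne'
  obtain ⟨q, hqp, C, hCt, hC⟩ := exists_weakType hn hδ hδn hp
  -- The constant of `sharpMaximalFunction_le` is at most `2 ^ N`.
  set N : ℤ := 2 * n + 2 with hN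
  set M : ℝ≥0∞ := 2 ^ p * 2 ^ ((N : ℝ) * p) * (C * 2 ^ q * (1 - 2 ^ (q - p))⁻¹) with hM
  have hMt : M ≠ ∞ := ENNReal.mul_ne_top (ENNReal.mul_ne_top (h2t _) (h2t _))
    (ENNReal.mul_ne_top (ENNReal.mul_ne_top hCt (h2t _)) (hgeom _ (by linarith)))
  have hct : M * (1 - 2 ^ (-p))⁻¹ ≠ ∞ := ENNReal.mul_ne_top hMt (hgeom _ (by linarith))
  refine ⟨(M * (1 - 2 ^ (-p))⁻¹).toNNReal, fun f hf => ?_⟩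
  rw [ENNReal.coe_toNNReal hct, mul_assoc]
  set H := hausdorffContent n δ with hH
  set S := ∑' l : ℤ, 2 ^ ((l : ℝ) * p) * H {x | 2 ^ (l : ℝ) < (f x).abs} with hS
  have hSle : S ≤ (1 - 2 ^ (-p))⁻¹ * choquetIntegral H Set.univ (fun x => (f x).abs ^ p) :=
    tsum_le_choquetIntegral_rpow hmono _ hp0
  have hSt : S ≠ ∞ := ne_top_of_le_ne_top
    (ENNReal.mul_ne_top (hgeom _ (by linarith)) (ne_of_lt hf)) hSle
  refine le_trans ?_ (mul_le_mul_right hSle _)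
  refine ENNReal.le_mul_of_forall_le_mul_add hMt fun ε hε => ?_
  -- The error `ε` allows for superlevel sets of content zero, whose covers may not be free.
  obtain ⟨ε', hε'0, hε'⟩ := ENNReal.exists_pos_sum_of_countable' hε ℤ
  have hcover : ∀ l : ℤ, ∃ (c : ℕ → EuclideanSpace ℝ (Fin n)) (r : ℕ → ℝ≥0),
      {x | 2 ^ (l : ℝ) < (f x).abs} ⊆ (⋃ i, Metric.ball (c i) (r i : ℝ)) ∧
      2 ^ ((l : ℝ) * p) * ∑' i, (r i : ℝ≥0∞) ^ δ ≤
        2 ^ ((l : ℝ) * p) * H {x | 2 ^ (l : ℝ) < (f x).abs} + ε' l := by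
    intro l
    have hfin : H {x | 2 ^ (l : ℝ) < (f x).abs} ≠ ∞ := by
      intro h
      apply hSt
      refine top_le_iff.1 (le_trans (le_of_eq ?_) (ENNReal.le_tsum l))
      rw [h, ENNReal.mul_top (h20 _)]
    obtain ⟨c, r, hcr, hle⟩ := exists_cover_tsum_le
      (ENNReal.div_pos (hε'0 l).ne' (h2t ((l : ℝ) * p))).ne' hfin
    refine ⟨c, r, hcr, (mul_le_mul_right hle _).trans (le_of_eq ?_)⟩
    rw [mul_add, ENNReal.mul_div_cancel (h20 _) (h2t _)]
  choose c r hcr hsum using hcover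
  have hsub : ∀ k : ℤ, {x | 2 ^ ((k + N : ℤ) : ℝ) < sharpMaximalFunction n n f x} ⊆
      maximalSuperlevel (fun j : ℕ × ℕ => c (k + j.1) j.2) (fun j => r (k + j.1) j.2)
        (fun j => 2 ^ ((k + j.1 + 1 : ℤ) : ℝ)) (2 ^ (k : ℝ)) := by
    intro k x hx
    by_contra hx'
    have h1 := sharpMaximalFunction_le hn _ _ _ _ (f := f) (fun y => ?_) hx'
    · refine absurd hx (not_lt.2 (h1.trans ?_))
      rw [ENNReal.coe_rpow_of_ne_zero two_ne_zero, ENNReal.coe_ofNat, Int.cast_add,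
        add_comm (k : ℝ), ENNReal.rpow_add _ _ two_ne_zero ENNReal.ofNat_ne_top]
      gcongr
      have h3 : (2 : ℝ≥0) ^ n * (2 + 2 ^ n * 2) ≤ 2 ^ (2 * n + 2) := by
        have h4 : (1 : ℝ≥0) ≤ 2 ^ n := one_le_pow₀ one_le_two
        calc (2 : ℝ≥0) ^ n * (2 + 2 ^ n * 2) ≤ 2 ^ n * (2 ^ n * 2 + 2 ^ n * 2) := by
              gcongr
              exact le_mul_of_one_le_left' h4
          _ = _ := by ring
      have h5 : (N : ℝ) = ((2 * n + 2 : ℕ) : ℝ) := by rw [hN]; push_cast; ring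
      rw [h5, ENNReal.rpow_natCast, ENNReal.rpow_natCast]
      exact_mod_cast h3
    · rw [ENNReal.coe_rpow_of_ne_zero two_ne_zero, ENNReal.coe_ofNat]
      exact le_two_rpow_add_tsum_layers hcr k y
  calc choquetIntegral H Set.univ (fun x => sharpMaximalFunction n n f x ^ p)
      ≤ 2 ^ p * ∑' l : ℤ, 2 ^ ((l : ℝ) * p) * H {x | 2 ^ (l : ℝ) < sharpMaximalFunction n n f x} :=
        choquetIntegral_rpow_le_tsum hmono _ hp0
    _ = 2 ^ p * ∑' k : ℤ, 2 ^ (((k + N : ℤ) : ℝ) * p) *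
          H {x | 2 ^ ((k + N : ℤ) : ℝ) < sharpMaximalFunction n n f x} := by
        rw [← (Equiv.addRight N).tsum_eq]
        rfl
    _ ≤ 2 ^ p * ∑' k : ℤ, 2 ^ ((N : ℝ) * p) * (2 ^ ((k : ℝ) * p) * H (maximalSuperlevel
          (fun j : ℕ × ℕ => c (k + j.1) j.2) (fun j => r (k + j.1) j.2)
          (fun j => 2 ^ ((k + j.1 + 1 : ℤ) : ℝ)) (2 ^ (k : ℝ)))) := by
        refine mul_le_mul_right (ENNReal.tsum_le_tsum fun k => ?_) _
        rw [← mul_assoc, ← ENNReal.rpow_add _ _ two_ne_zero ENNReal.ofNat_ne_top, ← add_mul,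
          Int.cast_add, add_comm (N : ℝ)]
        refine mul_le_mul_right (hmono ?_) _
        rw [← Int.cast_add]
        exact hsub k
    _ ≤ 2 ^ p * (2 ^ ((N : ℝ) * p) * (C * 2 ^ q * (1 - 2 ^ (q - p))⁻¹ *
          ∑' l : ℤ, 2 ^ ((l : ℝ) * p) * ∑' i, (r l i : ℝ≥0∞) ^ δ)) := by
        rw [ENNReal.tsum_mul_left]
        gcongr
        exact tsum_hausdorffContent_maximalSuperlevel_le hC c r
    _ = M * ∑' l : ℤ, 2 ^ ((l : ℝ) * p) * ∑' i, (r l i : ℝ≥0∞) ^ δ := by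
        rw [hM]
        ring
    _ ≤ M * (S + ε) := by
        refine mul_le_mul_right ((ENNReal.tsum_le_tsum hsum).trans ?_) _
        rw [ENNReal.tsum_add]
        gcongr
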